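/- Let $K$ be a field and let $G$ be a connected simple graph on a finite vertex set $V$. Let $S=K[x_i,y_i : i\in V]$ be the polynomial ring with its standard grading, and let $$J_G=\langle x_iy_j-x_jy_i : \{i,j\}\in E(G)\rangle\subseteq S$$ be the binomial edge ideal of $G$. For a proper graded ideal $I\subseteq S$, let $\mathrm{Ass}(I)$ be the set of prime ideals of the form $(I:f)$ with $f\in S$ homogeneous, and let the $\mathrm{v}$-number of $I$ be $$\mathrm{v}(I)=\min\{d\ge 0 : \text{there are a homogeneous } f\in S_d \text{ and } \mathfrak p\in\mathrm{Ass}(I) \text{ with } (I:f)=\mathfrak p\}.$$ For a simple graph $H$ and a vertex $v\notin V(H)$, let $\mathrm{cone}(v,H)$ be the graph with vertex set $V(H)\cup\{v\}$ and edge set $E(H)\cup\{\{u,v\} : u\in V(H)\}$. Then $\mathrm{v}(J_G)=1$ if and only if $G=\mathrm{cone}(v,H)$ for some vertex $v$ and some non-complete graph $H$ with $v\notin V(H)$. (A graph is complete if any two distinct vertices are adjacent; in particular, the graphs with at most one vertex are complete.) -/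

import Mathlib

noncomputable section

/-- `Ass(I)` for an ideal `I` of `K[σ]`: the prime ideals of the form `(I : f)` with `f`
homogeneous (of some degree) for the standard grading. -/
def assPrimes {σ K : Type*} [Field K] (I : Ideal (MvPolynomial σ K)) :
    Set (Ideal (MvPolynomial σ K)) :=
  {p | p.IsPrime ∧ ∃ (d : ℕ) (f : MvPolynomial σ K), f.IsHomogeneous d ∧ I.colon {f} = p}

/-- The v-number of an ideal `I` of `K[σ]`: the least `d` such that `(I : f)` is an associated
prime of `I` for some `f` homogeneous of degree `d`. (When there is no such `d`, which does not
happen for a proper graded ideal in finitely many variables, the value is `0`.) -/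
def vNumber {σ K : Type*} [Field K] (I : Ideal (MvPolynomial σ K)) : ℕ :=
  sInf {d : ℕ | ∃ f : MvPolynomial σ K, f.IsHomogeneous d ∧ ∃ p ∈ assPrimes I, I.colon {f} = p}

/-- The binomial edge ideal of `G`, generated by `x i * y j - x j * y i` for the edges `{i, j}`
of `G`, in the polynomial ring with variables `x i = X (Sum.inl i)` and `y i = X (Sum.inr i)`.
Exchanging `i` and `j` only changes the sign of the generator, so no order of the vertices is
needed. -/
def binomialEdgeIdeal (K : Type*) [Field K] {V : Type*} (G : SimpleGraph V) :
    Ideal (MvPolynomial (V ⊕ V) K) :=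
  Ideal.span {g | ∃ i j : V, G.Adj i j ∧
    g = MvPolynomial.X (Sum.inl i) * MvPolynomial.X (Sum.inr j)
      - MvPolynomial.X (Sum.inl j) * MvPolynomial.X (Sum.inr i)}

/-- The cone of `v` on `H`, where `V(H) = V \ {v}`: the graph on `V(H) ∪ {v} = V` whose edges are
those of `H` together with all `{u, v}`, `u ∈ V(H)`. -/
def coneGraph {V : Type*} (v : V) (H : SimpleGraph {u : V // u ≠ v}) : SimpleGraph V where
  Adj a b := (∃ (ha : a ≠ v) (hb : b ≠ v), H.Adj ⟨a, ha⟩ ⟨b, hb⟩) ∨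
    (a ≠ v ∧ b = v) ∨ (a = v ∧ b ≠ v)
  symm := ⟨by
    rintro a b (⟨ha, hb, h⟩ | ⟨ha, hb⟩ | ⟨ha, hb⟩)
    · exact Or.inl ⟨hb, ha, h.symm⟩
    · exact Or.inr (Or.inr ⟨hb, ha⟩)
    · exact Or.inr (Or.inl ⟨hb, ha⟩)⟩
  loopless := ⟨by
    rintro a (⟨ha, hb, h⟩ | ⟨ha, hb⟩ | ⟨ha, hb⟩)
    · exact h.ne rfl
    · exact ha hb
    · exact hb ha⟩

end

/-!
Write `f i j = x i * y j - x j * y i`, and let `P` be the binomial edge ideal of the complete graph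
on `V`, generated by all `f i j`. Everything rests on the primality of `P`
(`isPrime_binomialEdgeIdeal_top`): `P` is the kernel of `x i ↦ s * z i`, `y i ↦ t * z i`. This map
sends monomials to monomials, and two monomials with the same image can be joined by exchanges
`x i * y j ↔ x j * y i` (`prod_X_sub_prod_X_mem`).

The v-number is `0` exactly when `J_G` is prime. The identity
`x j * f i k = x i * f j k + x k * f i j` shows, along a walk, that a prime ideal that contains
`J_G` but no `x j` contains `P`. As `P` contains no variable, `J_G` is prime only if `J_G = P`, and
then `G` is complete: setting all variables to zero except those of two nonadjacent vertices `j`,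
`k` kills `J_G`, but not `f j k`.

If `v` is adjacent to all other vertices, the same identity gives `(J_G : x v) = P`
(`colon_X_eq_of_forall_adj`), so the v-number is at most `1`. Conversely, let `(J_G : f)` be prime
with `f` linear. It is contained in `P`, because `f` is not in the prime ideal `P`; hence it contains
no variable, hence it contains `P`, and so `f * f j k` is in `J_G` for all `j`, `k`. If a variable of
the vertex `j` occurs in `f`, then setting all variables to zero except those of `j` and `k` does
not kill `f * f j k`, and `j` is adjacent to `k` (`exists_forall_adj_of_isPrime_colon`).
-/

open MvPolynomial

/-- The vertex of a variable: `i` for both `x i` and `y i`. -/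
def varVertex {V : Type*} : V ⊕ V → V := Sum.elim id id

/-- The binomial `x i * y j - x j * y i`. -/
noncomputable def edgeBinomial (K : Type*) [Field K] {V : Type*} (i j : V) :
    MvPolynomial (V ⊕ V) K :=
  X (Sum.inl i) * X (Sum.inr j) - X (Sum.inl j) * X (Sum.inr i)

section

variable {K : Type*} [Field K] {V : Type*}

theorem edgeBinomial_self (i : V) : edgeBinomial K i i = 0 := sub_self _

theorem edgeBinomial_mem {G : SimpleGraph V} {i j : V} (h : G.Adj i j) :
    edgeBinomial K i j ∈ binomialEdgeIdeal K G :=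
  Ideal.subset_span ⟨i, j, h, rfl⟩

theorem edgeBinomial_mem_top (i j : V) :
    edgeBinomial K i j ∈ binomialEdgeIdeal K (⊤ : SimpleGraph V) := by
  by_cases h : i = j
  · subst h
    rw [edgeBinomial_self]
    exact zero_mem _
  · exact edgeBinomial_mem h

theorem binomialEdgeIdeal_le {G : SimpleGraph V} {I : Ideal (MvPolynomial (V ⊕ V) K)}
    (h : ∀ i j, G.Adj i j → edgeBinomial K i j ∈ I) : binomialEdgeIdeal K G ≤ I := by
  refine Ideal.span_le.2 ?_
  rintro _ ⟨i, j, hij, rfl⟩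
  exact h i j hij

theorem binomialEdgeIdeal_le_top (G : SimpleGraph V) :
    binomialEdgeIdeal K G ≤ binomialEdgeIdeal K ⊤ :=
  binomialEdgeIdeal_le fun i j _ => edgeBinomial_mem_top i j

/-- The Plücker-type relation `z j * f i k = z i * f j k + z k * f i j` for `z = x` and `z = y`,
where `f a b = x a * y b - x b * y a`. -/
theorem X_mul_edgeBinomial_mem {I : Ideal (MvPolynomial (V ⊕ V) K)} {i j k : V}
    (hij : edgeBinomial K i j ∈ I) (hjk : edgeBinomial K j k ∈ I) :
    X (Sum.inl j) * edgeBinomial K i k ∈ I := by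
  have h : X (Sum.inl j) * edgeBinomial K i k =
      X (Sum.inl i) * edgeBinomial K j k + X (Sum.inl k) * edgeBinomial K i j := by
    simp only [edgeBinomial]
    ring
  rw [h]
  exact add_mem (I.mul_mem_left _ hjk) (I.mul_mem_left _ hij)

/-! ### Primality for the complete graph -/

/-- The parametrization `x i ↦ s * z i`, `y i ↦ t * z i` of the `2 × V` matrices of rank at
most one. The target has the variables `s`, `t` (indexed by `true`, `false`) and `z i`. -/
noncomputable def rankOneParam (K : Type*) [Field K] (V : Type*) :
    MvPolynomial (V ⊕ V) K →ₐ[K] MvPolynomial (Bool ⊕ V) K :=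
  aeval fun e => X (Sum.inl e.isLeft) * X (Sum.inr (varVertex e))

theorem binomialEdgeIdeal_le_ker (G : SimpleGraph V) :
    binomialEdgeIdeal K G ≤ RingHom.ker (rankOneParam K V) := by
  refine binomialEdgeIdeal_le fun i j _ => ?_
  simp only [RingHom.mem_ker, edgeBinomial, rankOneParam, map_sub, map_mul, aeval_X, varVertex,
    Sum.isLeft_inl, Sum.isLeft_inr, Sum.elim_inl, Sum.elim_inr, id_eq]
  ring

/-- Two monomials of the same multidegree in the rows and in the columns of the matrix agree
modulo its `2`-minors. -/
theorem prod_X_sub_prod_X_mem (m : Multiset (V ⊕ V)) : ∀ m' : Multiset (V ⊕ V),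
    m.map Sum.isLeft = m'.map Sum.isLeft → m.map varVertex = m'.map varVertex →
    (m.map X).prod - (m'.map X).prod ∈ binomialEdgeIdeal K (⊤ : SimpleGraph V) := by
  classical
  induction m using Multiset.induction_on with
  | empty =>
    intro m' h _
    have : m' = 0 := by simpa using h.symm
    simp [this]
  | cons e m ih =>
    intro m' hs hv
    by_cases he : e ∈ m'
    · obtain ⟨m'', rfl⟩ := Multiset.exists_cons_of_mem he
      simp only [Multiset.map_cons, Multiset.cons_inj_right, Multiset.prod_cons] at hs hv ⊢
      rw [← mul_sub]
      exact Ideal.mul_mem_left _ _ (ih m'' hs hv)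
    -- `m'` has a variable `u` in the row of `e` and another one `w` in the column of `e`;
    -- the minor through `u` and `w` exchanges them for `e` and a variable `w'`.
    · have hu : e.isLeft ∈ m'.map Sum.isLeft := by rw [← hs]; simp
      have hw : varVertex e ∈ m'.map varVertex := by rw [← hv]; simp
      obtain ⟨u, hu, hue⟩ := Multiset.mem_map.1 hu
      obtain ⟨w, hw, hwe⟩ := Multiset.mem_map.1 hw
      have huw : w ≠ u := by
        rintro rfl
        apply he
        rcases w with a | a <;> rcases e with b | b <;> simp_all [varVertex]
      obtain ⟨m₁, rfl⟩ := Multiset.exists_cons_of_mem hu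
      obtain ⟨m₂, rfl⟩ := Multiset.exists_cons_of_mem ((Multiset.mem_cons.1 hw).resolve_left huw)
      have hwe' : w ≠ e := by rintro rfl; simp at he
      obtain ⟨w', hw's, hw'v, hmem⟩ : ∃ w' : V ⊕ V, w'.isLeft = w.isLeft ∧
          varVertex w' = varVertex u ∧
          (X e * X w' - X u * X w : MvPolynomial (V ⊕ V) K) ∈ binomialEdgeIdeal K ⊤ := by
        rcases e with i | i <;> rcases u with a | a <;> rcases w with b | b <;>
          simp only [varVertex, Sum.isLeft_inl, Sum.isLeft_inr, Sum.elim_inl, Sum.elim_inr, id_eq,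
            Bool.true_eq_false, Bool.false_eq_true] at hue hwe <;> subst hwe
        · exact absurd rfl hwe'
        · exact ⟨Sum.inr a, rfl, rfl, edgeBinomial_mem_top b a⟩
        · refine ⟨Sum.inl a, rfl, rfl, ?_⟩
          have h := edgeBinomial_mem_top (K := K) a b
          simp only [edgeBinomial] at h
          rwa [mul_comm (X (Sum.inr b)), mul_comm (X (Sum.inr a))]
        · exact absurd rfl hwe'
      have h := ih (w' ::ₘ m₂)
        (by
          simp only [Multiset.map_cons, hue, Multiset.cons_inj_right] at hs ⊢
          rw [hs, hw's])
        (by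
          simp only [Multiset.map_cons, hwe] at hv ⊢
          rw [Multiset.cons_swap, Multiset.cons_inj_right] at hv
          rw [hv, hw'v])
      simp only [Multiset.map_cons, Multiset.prod_cons] at h ⊢
      have key := add_mem (Ideal.mul_mem_left _ (X e) h)
        (Ideal.mul_mem_right (m₂.map X).prod _ hmem)
      convert key using 1
      ring

theorem monomial_one_eq_prod_toMultiset {σ : Type*} (m : σ →₀ ℕ) :
    (monomial m 1 : MvPolynomial σ K) = ((Finsupp.toMultiset m).map X).prod := by
  rw [monomial_eq, C_1, one_mul, Finsupp.toMultiset_map, Finsupp.prod_toMultiset,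
    Finsupp.prod_mapDomain_index (by simp) (by simp [pow_add])]

theorem rankOneParam_monomial (m : V ⊕ V →₀ ℕ) :
    rankOneParam K V (monomial m 1) =
      monomial (m.mapDomain (Sum.inl ∘ Sum.isLeft) + m.mapDomain (Sum.inr ∘ varVertex)) 1 := by
  rw [← one_mul (1 : K), ← monomial_mul, one_mul]
  simp only [monomial_one_eq_prod_toMultiset, map_multiset_prod, ← Finsupp.toMultiset_map,
    Multiset.map_map, Function.comp_def, rankOneParam, aeval_X, Multiset.prod_map_mul]

theorem filterMap_const_none {α β : Type*} (s : Multiset α) :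
    s.filterMap (fun _ => (none : Option β)) = 0 := by
  induction s using Multiset.induction_on with
  | empty => rfl
  | cons a s ih => rw [Multiset.filterMap_cons_none _ _ rfl, ih]

theorem filterMap_some_comp {α β : Type*} (g : α → β) (s : Multiset α) :
    s.filterMap (fun a => some (g a)) = s.map g :=
  congrFun (Multiset.filterMap_eq_map g) s

/-- The `2`-minors of the generic `2 × V` matrix generate the kernel of `rankOneParam`, since
`rankOneParam` sends monomials to monomials and identifies only monomials that are congruent. -/
theorem ker_rankOneParam :
    RingHom.ker (rankOneParam K V) = binomialEdgeIdeal K (⊤ : SimpleGraph V) := by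
  refine le_antisymm (fun p hp => ?_) (binomialEdgeIdeal_le_ker _)
  let E : (V ⊕ V →₀ ℕ) → (Bool ⊕ V →₀ ℕ) := fun m =>
    m.mapDomain (Sum.inl ∘ Sum.isLeft) + m.mapDomain (Sum.inr ∘ varVertex)
  have hE : ∀ m m', E m = E m' →
      (monomial m 1 - monomial m' 1 : MvPolynomial (V ⊕ V) K) ∈ binomialEdgeIdeal K ⊤ := by
    intro m m' h
    rw [monomial_one_eq_prod_toMultiset, monomial_one_eq_prod_toMultiset]
    have h' := congrArg Finsupp.toMultiset h
    simp only [E, map_add, ← Finsupp.toMultiset_map] at h'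
    have h₁ := congrArg (Multiset.filterMap Sum.getLeft?) h'
    have h₂ := congrArg (Multiset.filterMap Sum.getRight?) h'
    simp only [Multiset.filterMap_add, Multiset.filterMap_map, Function.comp_def,
      Sum.getLeft?_inl, Sum.getLeft?_inr, Sum.getRight?_inl, Sum.getRight?_inr,
      filterMap_const_none, add_zero, zero_add] at h₁ h₂
    exact prod_X_sub_prod_X_mem _ _ ((filterMap_some_comp _ _).symm.trans
      (h₁.trans (filterMap_some_comp _ _))) ((filterMap_some_comp _ _).symm.trans
      (h₂.trans (filterMap_some_comp _ _)))
  -- `ψ` sends a monomial to a monomial in its fibre, so `ψ (rankOneParam p)` is congruent to `p`.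
  let ψ : MvPolynomial (Bool ⊕ V) K →ₗ[K] MvPolynomial (V ⊕ V) K :=
    (basisMonomials _ K).constr K fun n => monomial (Function.invFun E n) 1
  have hψ : ∀ q, q - ψ (rankOneParam K V q) ∈ binomialEdgeIdeal K (⊤ : SimpleGraph V) := by
    intro q
    induction q using MvPolynomial.induction_on' with
    | monomial m c =>
      have hc : (monomial m c : MvPolynomial (V ⊕ V) K) = c • monomial m 1 := by
        simp [smul_monomial]
      have hm : ψ (monomial (E m) 1) = monomial (Function.invFun E (E m)) 1 := by
        have := (basisMonomials (Bool ⊕ V) K).constr_basis K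
          (fun n => (monomial (Function.invFun E n) 1 : MvPolynomial (V ⊕ V) K)) (E m)
        rwa [coe_basisMonomials] at this
      rw [hc, map_smul, rankOneParam_monomial, map_smul, hm, ← smul_sub]
      exact Submodule.smul_of_tower_mem _ c (hE _ _ (Function.invFun_eq ⟨m, rfl⟩).symm)
    | add p q hp hq =>
      rw [map_add, map_add, add_sub_add_comm]
      exact add_mem hp hq
  have h := hψ p
  rwa [RingHom.mem_ker.1 hp, map_zero, sub_zero] at h

theorem isPrime_binomialEdgeIdeal_top :
    (binomialEdgeIdeal K (⊤ : SimpleGraph V)).IsPrime := by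
  rw [← ker_rankOneParam]
  exact RingHom.ker_isPrime _

theorem X_notMem_binomialEdgeIdeal_top (e : V ⊕ V) :
    (X e : MvPolynomial (V ⊕ V) K) ∉ binomialEdgeIdeal K (⊤ : SimpleGraph V) := by
  rw [← ker_rankOneParam, RingHom.mem_ker, rankOneParam, aeval_X]
  exact mul_ne_zero (X_ne_zero _) (X_ne_zero _)

/-! ### Linear forms and specializations -/

/-- A nonzero linear form has a nonzero coefficient, its value at a unit vector. -/
theorem exists_eval_single_ne_zero {σ : Type*} [DecidableEq σ] {f : MvPolynomial σ K}
    (hf : f.IsHomogeneous 1) (h0 : f ≠ 0) : ∃ e, eval (Pi.single e 1) f ≠ 0 := by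
  by_contra! h
  apply h0
  have hmem : f ∈ Submodule.span K (Set.range (X : σ → MvPolynomial σ K)) := by
    rw [← homogeneousSubmodule_one_eq_span_X]
    exact hf
  obtain ⟨c, rfl⟩ := (Finsupp.mem_span_range_iff_exists_finsupp).1 hmem
  have hc : c = 0 := by
    ext e
    have := h e
    rw [Finsupp.sum, map_sum] at this
    simpa [smul_eval, Pi.single_apply] using this
  simp [hc]

theorem binomialEdgeIdeal_le_ker_eval_single [DecidableEq V] (G : SimpleGraph V) (e : V ⊕ V) :
    binomialEdgeIdeal K G ≤ RingHom.ker (eval (Pi.single e (1 : K))) := by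
  refine binomialEdgeIdeal_le fun i j hij => ?_
  have := hij.ne
  rcases e with a | a <;> simp [RingHom.mem_ker, edgeBinomial, Pi.single_apply]

theorem linear_notMem_binomialEdgeIdeal (G : SimpleGraph V) {f : MvPolynomial (V ⊕ V) K}
    (hf : f.IsHomogeneous 1) (h0 : f ≠ 0) : f ∉ binomialEdgeIdeal K G := by
  classical
  obtain ⟨e, he⟩ := exists_eval_single_ne_zero hf h0
  exact fun h => he (binomialEdgeIdeal_le_ker_eval_single G e h)

open Classical in
/-- The specialization that sets all variables to zero except those of the vertices `j`, `k`. -/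
noncomputable def restrictPair (K : Type*) [Field K] {V : Type*} (j k : V) :
    MvPolynomial (V ⊕ V) K →ₐ[K] MvPolynomial (V ⊕ V) K :=
  aeval fun e => if varVertex e = j ∨ varVertex e = k then X e else 0

theorem eval_restrictPair {j k : V} {a : V ⊕ V → K}
    (ha : ∀ e, varVertex e ≠ j → varVertex e ≠ k → a e = 0) (p : MvPolynomial (V ⊕ V) K) :
    eval a (restrictPair K j k p) = eval a p := by
  suffices h : (aeval a).comp (restrictPair K j k) = (aeval a : MvPolynomial (V ⊕ V) K →ₐ[K] K) by
    simpa [aeval_eq_eval] using DFunLike.congr_fun h p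
  ext e
  by_cases h : varVertex e = j ∨ varVertex e = k
  · simp [restrictPair, h]
  · push Not at h
    simp [restrictPair, h.1, h.2, ha e h.1 h.2]

theorem restrictPair_eq_zero_of_mem {G : SimpleGraph V} {j k : V} (h : ¬ G.Adj j k)
    {p : MvPolynomial (V ⊕ V) K} (hp : p ∈ binomialEdgeIdeal K G) :
    restrictPair K j k p = 0 := by
  suffices H : binomialEdgeIdeal K G ≤ RingHom.ker (restrictPair K j k) from H hp
  refine binomialEdgeIdeal_le fun a b hab => ?_
  have h' : ¬ G.Adj k j := fun h' => h h'.symm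
  by_cases ha : a = j ∨ a = k
  · have hb : ¬ (b = j ∨ b = k) := by
      rintro (rfl | rfl) <;> rcases ha with rfl | rfl
      exacts [hab.ne rfl, h' hab, h hab, hab.ne rfl]
    simp [RingHom.mem_ker, edgeBinomial, restrictPair, varVertex, hb]
  · simp [RingHom.mem_ker, edgeBinomial, restrictPair, varVertex, ha]

theorem restrictPair_edgeBinomial_ne_zero {j k : V} (hjk : j ≠ k) :
    restrictPair K j k (edgeBinomial K j k) ≠ 0 := by
  classical
  intro h
  have h1 := eval_restrictPair (K := K) (j := j) (k := k)
    (a := Sum.elim (Pi.single j 1) (Pi.single k 1))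
    (by
      rintro (e | e) h1 h2
      · exact Pi.single_eq_of_ne h1 _
      · exact Pi.single_eq_of_ne h2 _) (edgeBinomial K j k)
  rw [h] at h1
  simp [edgeBinomial, hjk, hjk.symm] at h1

/-! ### Prime ideals containing `J_G` -/

theorem edgeBinomial_mem_of_isPrime {G : SimpleGraph V} (hG : G.Connected)
    {p : Ideal (MvPolynomial (V ⊕ V) K)} (hp : p.IsPrime) (hGp : binomialEdgeIdeal K G ≤ p)
    (hX : ∀ j, X (Sum.inl j) ∉ p) (i k : V) : edgeBinomial K i k ∈ p := by
  obtain ⟨w⟩ := hG.preconnected i k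
  induction w with
  | nil => rw [edgeBinomial_self]; exact zero_mem _
  | cons h _ ih =>
    exact (hp.mem_or_mem (X_mul_edgeBinomial_mem (hGp (edgeBinomial_mem h)) ih)).resolve_left (hX _)

theorem eq_top_of_isPrime {G : SimpleGraph V} (hG : G.Connected)
    (hp : (binomialEdgeIdeal K G).IsPrime) : G = ⊤ := by
  refine SimpleGraph.ext_iff.2 ?_
  ext j k
  refine ⟨fun h => h.ne, fun hjk => ?_⟩
  by_contra h
  have hmem := edgeBinomial_mem_of_isPrime hG hp le_rfl
    (fun j hj => X_notMem_binomialEdgeIdeal_top _ (binomialEdgeIdeal_le_top G hj)) j k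
  exact restrictPair_edgeBinomial_ne_zero hjk (restrictPair_eq_zero_of_mem h hmem)

/-- If `(J_G : f)` is prime for a linear form `f`, then some vertex is adjacent to all others,
namely that of any variable occurring in `f`. -/
theorem exists_forall_adj_of_isPrime_colon {G : SimpleGraph V} (hG : G.Connected)
    {f : MvPolynomial (V ⊕ V) K} (hf : f.IsHomogeneous 1)
    (hp : ((binomialEdgeIdeal K G).colon {f}).IsPrime) : ∃ j, ∀ k, k ≠ j → G.Adj j k := by
  classical
  have h0 : f ≠ 0 := by
    rintro rfl
    exact hp.ne_top ((Ideal.eq_top_iff_one _).2 (by simp [Submodule.mem_colon_singleton]))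
  -- `(J_G : f)` lies in `J_K` for the complete graph `K`, since that ideal is prime and has no
  -- linear forms; so it contains no variable.
  have hX : ∀ j, X (Sum.inl j) ∉ (binomialEdgeIdeal K G).colon {f} := by
    intro j hj
    rw [Submodule.mem_colon_singleton, smul_eq_mul] at hj
    rcases isPrime_binomialEdgeIdeal_top.mem_or_mem (binomialEdgeIdeal_le_top G hj) with h | h
    · exact X_notMem_binomialEdgeIdeal_top _ h
    · exact linear_notMem_binomialEdgeIdeal ⊤ hf h0 h
  have hle : binomialEdgeIdeal K G ≤ (binomialEdgeIdeal K G).colon {f} := fun g hg =>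
    Submodule.mem_colon_singleton.2 (Ideal.mul_mem_right _ _ hg)
  obtain ⟨e, he⟩ := exists_eval_single_ne_zero hf h0
  refine ⟨varVertex e, fun k hk => ?_⟩
  by_contra hadj
  have hmem := edgeBinomial_mem_of_isPrime hG hp hle hX (varVertex e) k
  rw [Submodule.mem_colon_singleton, smul_eq_mul] at hmem
  have hzero := restrictPair_eq_zero_of_mem hadj hmem
  rw [map_mul] at hzero
  refine (mul_ne_zero (restrictPair_edgeBinomial_ne_zero hk.symm) fun hf0 => he ?_) hzero
  rw [← eval_restrictPair (j := varVertex e) (k := k), hf0, map_zero]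
  intro e' he' _
  exact Pi.single_eq_of_ne (by rintro rfl; exact he' rfl) _

/-- For a vertex `v` adjacent to all others, every `x v * f i k` is in `J_G`, which gives one
inclusion; the other one holds because `J_K`, for the complete graph `K`, is prime. -/
theorem colon_X_eq_of_forall_adj {G : SimpleGraph V} {v : V} (hv : ∀ k, k ≠ v → G.Adj v k) :
    (binomialEdgeIdeal K G).colon {X (Sum.inl v)} = binomialEdgeIdeal K ⊤ := by
  have hmem : ∀ k, edgeBinomial K v k ∈ binomialEdgeIdeal K G ∧
      edgeBinomial K k v ∈ binomialEdgeIdeal K G := by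
    intro k
    by_cases hk : k = v
    · subst hk
      simp [edgeBinomial_self]
    · exact ⟨edgeBinomial_mem (hv k hk), edgeBinomial_mem (hv k hk).symm⟩
  apply le_antisymm
  · intro g hg
    rw [Submodule.mem_colon_singleton, smul_eq_mul] at hg
    exact (isPrime_binomialEdgeIdeal_top.mem_or_mem (binomialEdgeIdeal_le_top G hg)).resolve_right
      (X_notMem_binomialEdgeIdeal_top _)
  · refine binomialEdgeIdeal_le fun i k _ => ?_
    rw [Submodule.mem_colon_singleton, smul_eq_mul, mul_comm]
    exact X_mul_edgeBinomial_mem (hmem i).2 (hmem k).1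

/-! ### The v-number -/

/-- The v-number takes the value `0` through `f = 1`. -/
theorem vNumber_eq_zero_of_isPrime {σ : Type*} {I : Ideal (MvPolynomial σ K)} (hI : I.IsPrime) :
    vNumber I = 0 := by
  have h : I.colon {(1 : MvPolynomial σ K)} = I := by
    ext g
    simp [Submodule.mem_colon_singleton]
  exact Nat.sInf_eq_zero.2 (Or.inl ⟨1, isHomogeneous_one _ _, I, ⟨hI, 0, 1,
    isHomogeneous_one _ _, h⟩, h⟩)

/-- A witness of degree zero is a nonzero constant. -/
theorem isPrime_of_isPrime_colon_of_isHomogeneous_zero {σ : Type*} {I : Ideal (MvPolynomial σ K)}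
    {f : MvPolynomial σ K} (hf : f.IsHomogeneous 0) (hp : (I.colon {f}).IsPrime) : I.IsPrime := by
  obtain ⟨c, rfl⟩ : ∃ c, f = C c := ⟨_, totalDegree_eq_zero_iff_eq_C.1 (by
    by_cases h : f = 0
    · simp [h]
    · exact hf.totalDegree h)⟩
  have hc : c ≠ 0 := by
    rintro rfl
    exact hp.ne_top ((Ideal.eq_top_iff_one _).2 (by simp [Submodule.mem_colon_singleton]))
  have h : I.colon {C c} = I := by
    ext g
    rw [Submodule.mem_colon_singleton, smul_eq_mul]
    exact Ideal.mul_unit_mem_iff_mem I ((isUnit_iff_ne_zero.2 hc).map C)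
  rwa [h] at hp

theorem vNumber_binomialEdgeIdeal_eq_one_iff {G : SimpleGraph V} (hG : G.Connected) :
    vNumber (binomialEdgeIdeal K G) = 1 ↔ G ≠ ⊤ ∧ ∃ v, ∀ k, k ≠ v → G.Adj v k := by
  constructor
  · intro h
    refine ⟨?_, ?_⟩
    · rintro rfl
      rw [vNumber_eq_zero_of_isPrime isPrime_binomialEdgeIdeal_top] at h
      exact zero_ne_one h
    · obtain ⟨f, hf, p, hp, hfp⟩ := Nat.sInf_mem (Nat.nonempty_of_sInf_eq_succ h)
      have hdeg : f.IsHomogeneous 1 := h ▸ hf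
      exact exists_forall_adj_of_isPrime_colon hG hdeg (hfp ▸ hp.1)
  · rintro ⟨hne, v, hv⟩
    have hcolon := colon_X_eq_of_forall_adj (K := K) hv
    have hX : (X (Sum.inl v) : MvPolynomial (V ⊕ V) K).IsHomogeneous 1 := isHomogeneous_X _ _
    refine le_antisymm (Nat.sInf_le ⟨_, hX, _, ⟨isPrime_binomialEdgeIdeal_top, 1, _, hX, hcolon⟩,
      hcolon⟩) (Nat.one_le_iff_ne_zero.2 fun h => ?_)
    rcases Nat.sInf_eq_zero.1 h with ⟨f, hf, p, hp, hfp⟩ | h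
    · exact hne (eq_top_of_isPrime hG
        (isPrime_of_isPrime_colon_of_isHomogeneous_zero hf (hfp ▸ hp.1)))
    -- The set is nonempty, so the value `0` is not the junk value of `sInf ∅`.
    · exact (Set.eq_empty_iff_forall_notMem.1 h 1) ⟨_, hX, _,
        ⟨isPrime_binomialEdgeIdeal_top, 1, _, hX, hcolon⟩, hcolon⟩

end

/-! ### Cones -/

theorem coneGraph_top {V : Type*} (v : V) : coneGraph v ⊤ = ⊤ := by
  ext a b
  simp only [coneGraph, SimpleGraph.top_adj, ne_eq, Subtype.mk.injEq]
  grind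

theorem coneGraph_ne_top {V : Type*} {v : V} {H : SimpleGraph {u : V // u ≠ v}} (hH : H ≠ ⊤) :
    coneGraph v H ≠ ⊤ := by
  intro h
  apply hH
  ext a b
  have hab := congrArg (fun G : SimpleGraph V => G.Adj a b) h
  simpa [coneGraph, a.2, b.2, Subtype.ext_iff] using hab

theorem eq_coneGraph_of_forall_adj {V : Type*} {G : SimpleGraph V} {v : V}
    (hv : ∀ k, k ≠ v → G.Adj v k) : G = coneGraph v (G.comap Subtype.val) := by
  ext a b
  by_cases ha : a = v
  · subst ha
    by_cases hb : b = a
    · simp [coneGraph, hb]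
    · simp [coneGraph, hb, hv b hb]
  · by_cases hb : b = v
    · subst hb
      simp [coneGraph, ha, (hv a ha).symm]
    · simp [coneGraph, ha, hb]

theorem theorem3p16 {K : Type*} [Field K] {V : Type*} [Finite V] (G : SimpleGraph V)
    (hG : G.Connected) :
    vNumber (binomialEdgeIdeal K G) = 1 ↔
      ∃ (v : V) (H : SimpleGraph {u : V // u ≠ v}), H ≠ ⊤ ∧ G = coneGraph v H := by
  rw [vNumber_binomialEdgeIdeal_eq_one_iff hG]
  constructor
  · rintro ⟨hne, v, hv⟩
    have h := eq_coneGraph_of_forall_adj hv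
    refine ⟨v, _, fun hH => hne ?_, h⟩
    rw [h, hH, coneGraph_top]
  · rintro ⟨v, H, hH, rfl⟩
    exact ⟨coneGraph_ne_top hH, v, fun k hk => Or.inr (Or.inr ⟨rfl, hk⟩)⟩
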